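/- Let $\kappa$ be a field of characteristic $0$, let $N$ be a lattice (a free abelian group of finite rank) with dual lattice $M$, and let $\Sigma_1,\Sigma_2\subseteq N_{\mathbb R}=N\otimes_{\mathbb Z}\mathbb R$ be (nonempty) fans of strongly convex rational polyhedral cones. For a fan $\Sigma$ let $u_\rho\in N$ be the minimal generator of the ray $\rho\in\Sigma(1)$, put $\nabla_\Sigma=\operatorname{Conv}(u_\rho\mid\rho\in\Sigma(1))$ and, for $P\subseteq N_{\mathbb R}$, $P^\circ=\{m\in M_{\mathbb R}\mid\langle m,n\rangle\ge -1\text{ for all }n\in P\}$. Assume that $\Sigma_1,\Sigma_2$ are simplicial with full-dimensional convex support, that the toric varieties $X_{\Sigma_1},X_{\Sigma_2}$ over $\kappa$ are quasi-projective, and that $\nabla_{\Sigma_1}=\nabla_{\Sigma_2}$. Let $\Xi\subseteq\nabla_{\Sigma_1}^\circ\cap M=\nabla_{\Sigma_2}^\circ\cap M$ be a finite set and let $c_m\in\kappa$ for $m\in\Xi$. For $j=1,2$ let $$w_j=\sum_{m\in\Xi}c_m\prod_{\rho\in\Sigma_j(1)}x_\rho^{\langle m,u_\rho\rangle+1}\in\kappa[x_\rho\mid\rho\in\Sigma_j(1)],$$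 and let $Z_{w,\Sigma_j}\subseteq X_{\Sigma_j}$ be the hypersurface $\{w_j=0\}$, that is, the closed subscheme that on the affine chart $U_\sigma=\operatorname{Spec}\kappa[\sigma^\vee\cap M]$, $\sigma\in\Sigma_j$, is defined by the preimage of the ideal generated by $w_j$ under the map $\kappa[\sigma^\vee\cap M]\to\kappa[x_\rho\mid\rho\in\Sigma_j(1)][x_\rho^{-1}\mid\rho\not\subseteq\sigma]$, $\chi^m\mapsto\prod_\rho x_\rho^{\langle m,u_\rho\rangle}$. If, for both $j=1$ and $j=2$, $w_j$ is not divisible by $x_\rho$ for any $\rho\in\Sigma_j(1)$, then $Z_{w,\Sigma_1}$ and $Z_{w,\Sigma_2}$ are birational over $\kappa$: they have dense open subschemes that are isomorphic over $\kappa$. -/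

import Mathlib

open CategoryTheory CategoryTheory.Limits AlgebraicGeometry TensorProduct

universe u

noncomputable section

namespace ToricHypersurface

section Lattice

variable (N : Type u) [AddCommGroup N]

/-- The character lattice `M = Hom(N, ℤ)` dual to the lattice `N`. -/
abbrev DualLattice : Type u := N →ₗ[ℤ] ℤ

/-- The real vector space `N_ℝ = ℝ ⊗ N`. -/
abbrev RealSpan : Type u := ℝ ⊗[ℤ] N

variable {N}

/-- The image in `N_ℝ` of a lattice point. -/
def toReal (v : N) : RealSpan N := (1 : ℝ) ⊗ₜ[ℤ] v

/-- The embedding of `M` into `M_ℝ = Hom(N_ℝ, ℝ)`: the real-linear extension of `m : N → ℤ`. -/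
def realExt (m : DualLattice N) : Module.Dual ℝ (RealSpan N) :=
  (AlgebraTensorModule.rid ℤ ℝ ℝ).toLinearMap ∘ₗ m.baseChange ℝ

lemma realExt_toReal (m : DualLattice N) (v : N) : realExt m (toReal v) = m v := by
  simp [realExt, toReal]

lemma realExt_add (m m' : DualLattice N) : realExt (m + m') = realExt m + realExt m' := by
  simp [realExt, LinearMap.baseChange_add, LinearMap.comp_add]

lemma realExt_zero : realExt (0 : DualLattice N) = 0 := by
  simp [realExt]

/-- The polar `{m ∈ M_ℝ | ⟨m, n⟩ ≥ -1 for all n ∈ P}` of a subset `P` of `N_ℝ`. -/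
def polar (P : Set (RealSpan N)) : Set (Module.Dual ℝ (RealSpan N)) :=
  {m | ∀ n ∈ P, -1 ≤ m n}

/-- A rational polyhedral cone: the cone over finitely many lattice points. -/
def IsRationalPolyhedral (σ : PointedCone ℝ (RealSpan N)) : Prop :=
  ∃ S : Finset N, σ = PointedCone.hull ℝ (toReal '' (S : Set N))

/-- A strongly convex cone: one that contains no line. -/
def IsStronglyConvex (σ : PointedCone ℝ (RealSpan N)) : Prop :=
  ∀ x ∈ σ, -x ∈ σ → x = 0

/-- The semigroup `σ^∨ ∩ M` of the lattice points of the dual cone. -/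
def dualMonoid (σ : PointedCone ℝ (RealSpan N)) : AddSubmonoid (DualLattice N) where
  carrier := {m | ∀ x ∈ σ, 0 ≤ realExt m x}
  zero_mem' := by
    intro x _
    simp [realExt_zero]
  add_mem' := by
    intro a b ha hb x hx
    rw [realExt_add]
    exact add_nonneg (ha x hx) (hb x hx)

/-- `τ` is a face of the rational polyhedral cone `σ`: it is cut out of `σ` by a supporting
hyperplane `m^⊥` with `m ∈ σ^∨ ∩ M`. -/
def IsFace (τ σ : PointedCone ℝ (RealSpan N)) : Prop :=
  ∃ m ∈ dualMonoid σ, ∀ x, x ∈ τ ↔ x ∈ σ ∧ realExt m x = 0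

lemma dualMonoid_anti {τ σ : PointedCone ℝ (RealSpan N)} (h : τ ≤ σ) :
    dualMonoid σ ≤ dualMonoid τ := fun _ hm x hx => hm x (h hx)

end Lattice

/-- A fan in `N_ℝ`: a finite nonempty collection of strongly convex rational polyhedral cones that
is closed under taking faces and in which any two cones meet in a common face.  (A nonempty
collection that is closed under faces contains the zero cone, and conversely.) -/
structure Fan (N : Type u) [AddCommGroup N] where
  cones : Set (PointedCone ℝ (RealSpan N))
  finite_cones : cones.Finite
  bot_mem : ⊥ ∈ cones
  rational : ∀ σ ∈ cones, IsRationalPolyhedral σ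
  stronglyConvex : ∀ σ ∈ cones, IsStronglyConvex σ
  face_mem : ∀ σ ∈ cones, ∀ τ, IsFace τ σ → τ ∈ cones
  inter_face : ∀ σ ∈ cones, ∀ τ ∈ cones, IsFace (σ ⊓ τ) σ ∧ IsFace (σ ⊓ τ) τ

namespace Fan

section Combinatorics

variable {N : Type u} [AddCommGroup N] (F : Fan N)

/-- The fan is simplicial: each of its cones is generated by linearly independent vectors. -/
def IsSimplicial : Prop := ∀ σ ∈ F.cones, σ.IsSimplicial

/-- The support `|F|`, the union of the cones. -/
def support : Set (RealSpan N) := {x | ∃ σ ∈ F.cones, x ∈ σ}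

/-- The support is convex and full-dimensional, that is, it spans `N_ℝ`. -/
def HasFullDimConvexSupport : Prop :=
  Convex ℝ F.support ∧ Submodule.span ℝ F.support = ⊤

/-- The set `{u_ρ | ρ ∈ F(1)}` of the minimal generators of the rays of the fan: the nonzero lattice
points `v` that span a cone `ρ = ℝ_{≥0} v` of the fan and generate the semigroup `ρ ∩ N`.
Since `ρ ↦ u_ρ` is a bijection, the rays of the fan are indexed by this set. -/
def rayGens : Set N :=
  {v | v ≠ 0 ∧ PointedCone.hull ℝ {toReal v} ∈ F.cones ∧
    ∀ v' : N, toReal v' ∈ PointedCone.hull ℝ {toReal v} → ∃ k : ℕ, v' = k • v}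

/-- The index type of the rays of the fan. -/
abbrev Ray : Type u := F.rayGens

/-- `∇_F`, the convex hull of the minimal generators of the rays. -/
def nabla : Set (RealSpan N) := convexHull ℝ (toReal '' F.rayGens)

/-- The cones of the fan, ordered by inclusion (which is the face relation). -/
abbrev Cone : Type u := F.cones

lemma finite_rayGens [Module.Free ℤ N] : F.rayGens.Finite := by
  refine Set.Finite.of_finite_image (f := fun v : N => PointedCone.hull ℝ {toReal v})
    (F.finite_cones.subset ?_) ?_
  · rintro _ ⟨v, hv, rfl⟩
    exact hv.2.1
  · intro v hv v' hv' h
    have h' : PointedCone.hull ℝ {toReal v} = PointedCone.hull ℝ {toReal v'} := h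
    obtain ⟨k, hk⟩ := hv.2.2 v' (h' ▸ PointedCone.subset_hull (Set.mem_singleton _))
    obtain ⟨l, hl⟩ := hv'.2.2 v (h' ▸ PointedCone.subset_hull (Set.mem_singleton _))
    have h1 : ((l * k : ℕ) : ℤ) • v = (1 : ℤ) • v := by
      rw [natCast_zsmul, mul_smul, ← hk, ← hl, one_smul]
    have h2 := smul_left_injective ℤ hv.1 h1
    have h3 : l * k = 1 := by exact_mod_cast h2
    have h4 : k = 1 := Nat.eq_one_of_mul_eq_one_left h3
    rw [hk, h4, one_smul]

instance [Module.Free ℤ N] : Finite F.Ray := F.finite_rayGens.to_subtype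

instance [Module.Free ℤ N] : Fintype F.Ray := Fintype.ofFinite _

instance : Finite F.Cone := F.finite_cones.to_subtype

end Combinatorics

section Variety

variable (κ : Type u) [Field κ] {N : Type u} [AddCommGroup N] (F : Fan N)

/-- The coordinate ring `κ[σ^∨ ∩ M]` of the affine toric variety `U_σ`. -/
abbrev ChartRing (σ : PointedCone ℝ (RealSpan N)) : Type u := AddMonoidAlgebra κ (dualMonoid σ)

/-- The restriction `κ[σ^∨ ∩ M] → κ[τ^∨ ∩ M]` for `τ ⊆ σ`. -/
def chartMap {τ σ : PointedCone ℝ (RealSpan N)} (h : τ ≤ σ) :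
    ChartRing κ σ →+* ChartRing κ τ :=
  AddMonoidAlgebra.mapDomainRingHom κ (AddSubmonoid.inclusion (dualMonoid_anti h))

lemma chartMap_single {τ σ : PointedCone ℝ (RealSpan N)} (h : τ ≤ σ) (m : dualMonoid σ) (r : κ) :
    chartMap κ h (AddMonoidAlgebra.single m r) =
      AddMonoidAlgebra.single (AddSubmonoid.inclusion (dualMonoid_anti h) m) r := by
  simp [chartMap]

lemma chartMap_injective {τ σ : PointedCone ℝ (RealSpan N)} (h : τ ≤ σ) :
    Function.Injective (chartMap κ h) :=
  AddMonoidAlgebra.mapDomain_injective (AddSubmonoid.inclusion_injective _)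

/-- A lattice point that is nonnegative on a face `τ = σ ∩ m^⊥` becomes nonnegative on `σ` after
adding a multiple of `m`. -/
lemma exists_add_nsmul_mem {τ σ : PointedCone ℝ (RealSpan N)} (hσ : IsRationalPolyhedral σ)
    {m : DualLattice N} (hm : m ∈ dualMonoid σ) (hτ : ∀ x, x ∈ τ ↔ x ∈ σ ∧ realExt m x = 0)
    {m' : DualLattice N} (hm' : m' ∈ dualMonoid τ) :
    ∃ k : ℕ, ∀ l : ℕ, k ≤ l → m' + l • m ∈ dualMonoid σ := by
  obtain ⟨S, rfl⟩ := hσ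
  refine ⟨∑ s ∈ S, (m' s).natAbs, fun l hl => ?_⟩
  intro x hx
  have key : ∀ s ∈ S, 0 ≤ (m' + l • m) s := by
    intro s hs
    have hsσ : toReal s ∈ PointedCone.hull ℝ (toReal '' (S : Set N)) :=
      PointedCone.subset_hull ⟨s, hs, rfl⟩
    have h0 : 0 ≤ m s := by
      have := hm _ hsσ
      rw [realExt_toReal] at this
      exact_mod_cast this
    have h1 : (m' s).natAbs ≤ l :=
      (Finset.single_le_sum (f := fun s => (m' s).natAbs) (fun _ _ => Nat.zero_le _) hs).trans hl
    simp only [LinearMap.add_apply, LinearMap.smul_apply, nsmul_eq_mul]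
    rcases h0.eq_or_lt with h0 | h0
    · have h2 : toReal s ∈ τ := (hτ _).2 ⟨hsσ, by rw [realExt_toReal, ← h0]; simp⟩
      have h3 := hm' _ h2
      rw [realExt_toReal] at h3
      have h4 : 0 ≤ m' s := by exact_mod_cast h3
      rw [← h0]
      simpa using h4
    · have h2 : -(m' s) ≤ l := by omega
      nlinarith
  refine Submodule.span_induction (p := fun x _ => 0 ≤ realExt (m' + l • m) x) ?_ ?_ ?_ ?_ hx
  · rintro _ ⟨s, hs, rfl⟩
    rw [realExt_toReal]
    exact_mod_cast key s hs
  · simp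
  · intro x y _ _ h1 h2
    rw [map_add]
    exact add_nonneg h1 h2
  · intro a x _ h1
    have : realExt (m' + l • m) (a • x) = (a : ℝ) * realExt (m' + l • m) x := by
      rw [← smul_eq_mul, ← map_smul]
      rfl
    rw [this]
    exact mul_nonneg a.2 h1

/-- For a face `τ = σ ∩ m^⊥`, the ring of `U_τ` is the localization of that of `U_σ` at `χ^m`. -/
lemma isLocalization_chartMap {τ σ : PointedCone ℝ (RealSpan N)} (hσ : IsRationalPolyhedral σ)
    (h : τ ≤ σ) (m : dualMonoid σ) (hτ : ∀ x, x ∈ τ ↔ x ∈ σ ∧ realExt m.1 x = 0) :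
    letI := (chartMap κ h).toAlgebra
    IsLocalization.Away (AddMonoidAlgebra.single m (1 : κ)) (ChartRing κ τ) := by
  let _ := (chartMap κ h).toAlgebra
  have halg : algebraMap (ChartRing κ σ) (ChartRing κ τ) = chartMap κ h := rfl
  have hpow : ∀ l : ℕ, chartMap κ h (AddMonoidAlgebra.single m (1 : κ)) ^ l =
      AddMonoidAlgebra.single (l • AddSubmonoid.inclusion (dualMonoid_anti h) m) 1 := by
    intro l
    rw [chartMap_single, AddMonoidAlgebra.single_pow, one_pow]
  have hneg : -m.1 ∈ dualMonoid τ := by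
    intro x hx
    have h1 : realExt (-m.1) + realExt m.1 = 0 := by
      rw [← realExt_add, neg_add_cancel, realExt_zero]
    have h2 := LinearMap.congr_fun h1 x
    rw [LinearMap.add_apply, ((hτ x).1 hx).2, add_zero] at h2
    exact h2.ge
  refine IsLocalization.Away.mk _ ?_ ?_ ?_
  · rw [halg, chartMap_single]
    refine IsUnit.of_mul_eq_one (AddMonoidAlgebra.single ⟨-m.1, hneg⟩ 1) ?_
    rw [AddMonoidAlgebra.single_mul_single, AddMonoidAlgebra.one_def]
    congr 1
    · ext1
      simp
    · simp
  · intro s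
    suffices H : ∃ k : ℕ, ∀ l : ℕ, k ≤ l → ∃ a, s * algebraMap (ChartRing κ σ) (ChartRing κ τ)
        (AddMonoidAlgebra.single m (1 : κ)) ^ l = algebraMap (ChartRing κ σ) (ChartRing κ τ) a by
      obtain ⟨k, hk⟩ := H
      exact ⟨k, hk k le_rfl⟩
    induction s using AddMonoidAlgebra.induction_linear with
    | zero => exact ⟨0, fun l _ => ⟨0, by simp⟩⟩
    | add f g hf hg =>
      obtain ⟨k, hk⟩ := hf
      obtain ⟨k', hk'⟩ := hg
      refine ⟨max k k', fun l hl => ?_⟩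
      obtain ⟨a, ha⟩ := hk l (le_trans (le_max_left _ _) hl)
      obtain ⟨b, hb⟩ := hk' l (le_trans (le_max_right _ _) hl)
      exact ⟨a + b, by rw [add_mul, ha, hb, map_add]⟩
    | single m' r =>
      obtain ⟨k, hk⟩ := exists_add_nsmul_mem hσ m.2 hτ m'.2
      refine ⟨k, fun l hl => ⟨AddMonoidAlgebra.single ⟨_, hk l hl⟩ r, ?_⟩⟩
      rw [halg, hpow, AddMonoidAlgebra.single_mul_single, chartMap_single, mul_one]
      congr 1
  · intro a b hab
    exact ⟨0, by rw [chartMap_injective κ h hab]⟩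

/-- The diagram of the affine toric varieties `U_σ = Spec κ[σ^∨ ∩ M]`, `σ` in the fan, with the
inclusions `U_τ → U_σ` for `τ ⊆ σ`. -/
def diagram : F.Cone ⥤ Scheme.{u} where
  obj σ := Spec (CommRingCat.of (ChartRing κ σ.1))
  map {τ σ} h := Spec.map (CommRingCat.ofHom (chartMap κ (leOfHom h)))
  map_id σ := by
    have : chartMap κ (le_refl σ.1) = RingHom.id (ChartRing κ σ.1) :=
      AddMonoidAlgebra.mapDomainRingHom_id
    rw [this]
    exact Spec.map_id _
  map_comp {ρ τ σ} f g := by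
    rw [← Spec.map_comp, ← CommRingCat.ofHom_comp]
    have : chartMap κ (leOfHom (f ≫ g)) =
        (chartMap κ (leOfHom f)).comp (chartMap κ (leOfHom g)) :=
      AddMonoidAlgebra.mapDomainRingHom_comp
        (AddSubmonoid.inclusion (dualMonoid_anti (leOfHom f)))
        (AddSubmonoid.inclusion (dualMonoid_anti (leOfHom g)))
    rw [this]

/-- Inclusion of cones of a fan is the face relation. -/
lemma isFace_of_le {τ σ : F.Cone} (h : τ ≤ σ) : IsFace τ.1 σ.1 := by
  have h1 := (F.inter_face σ.1 σ.2 τ.1 τ.2).1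
  rwa [inf_eq_right.2 h] at h1

lemma range_diagram_map {τ σ : F.Cone} (h : τ ⟶ σ) (m : dualMonoid σ.1)
    (hτ : ∀ x, x ∈ τ.1 ↔ x ∈ σ.1 ∧ realExt m.1 x = 0) :
    Set.range ((diagram κ F).map h) =
      (PrimeSpectrum.basicOpen (AddMonoidAlgebra.single m (1 : κ)) :
        Set (PrimeSpectrum (ChartRing κ σ.1))) := by
  let _ := (chartMap κ (leOfHom h)).toAlgebra
  have := isLocalization_chartMap κ (F.rational σ.1 σ.2) (leOfHom h) m hτ
  exact PrimeSpectrum.localization_away_comap_range (ChartRing κ τ.1)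
    (AddMonoidAlgebra.single m (1 : κ))

instance isOpenImmersion_diagram_map {τ σ : F.Cone} (h : τ ⟶ σ) :
    IsOpenImmersion ((diagram κ F).map h) := by
  obtain ⟨m, hm, hτ⟩ := F.isFace_of_le (leOfHom h)
  let _ := (chartMap κ (leOfHom h)).toAlgebra
  have := isLocalization_chartMap κ (F.rational σ.1 σ.2) (leOfHom h) ⟨m, hm⟩ hτ
  exact IsOpenImmersion.of_isLocalization (S := ChartRing κ τ.1)
    (AddMonoidAlgebra.single (⟨m, hm⟩ : dualMonoid σ.1) (1 : κ))

instance isLocallyDirected_diagram : (diagram κ F ⋙ Scheme.forget).IsLocallyDirected where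
  cond {τ₁ τ₂ σ} f₁ f₂ x₁ x₂ hx := by
    obtain ⟨m₁, hm₁, h₁⟩ := F.isFace_of_le (leOfHom f₁)
    obtain ⟨m₂, hm₂, h₂⟩ := F.isFace_of_le (leOfHom f₂)
    let ρ : F.Cone := ⟨τ₁.1 ⊓ τ₂.1,
      F.face_mem _ τ₁.2 _ (F.inter_face _ τ₁.2 _ τ₂.2).1⟩
    let g₁ : ρ ⟶ τ₁ := homOfLE (show τ₁.1 ⊓ τ₂.1 ≤ τ₁.1 from inf_le_left)
    let g₂ : ρ ⟶ τ₂ := homOfLE (show τ₁.1 ⊓ τ₂.1 ≤ τ₂.1 from inf_le_right)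
    have hρ : ∀ x, x ∈ ρ.1 ↔ x ∈ σ.1 ∧ realExt (m₁ + m₂) x = 0 := by
      intro x
      rw [show x ∈ ρ.1 ↔ x ∈ τ₁.1 ∧ x ∈ τ₂.1 from Iff.rfl, h₁, h₂, realExt_add,
        LinearMap.add_apply]
      constructor
      · rintro ⟨⟨hxσ, a⟩, -, b⟩
        exact ⟨hxσ, by rw [a, b, add_zero]⟩
      · rintro ⟨hxσ, a⟩
        have b₁ := hm₁ x hxσ
        have b₂ := hm₂ x hxσ
        exact ⟨⟨hxσ, by linarith⟩, hxσ, by linarith⟩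
    change (diagram κ F).map f₁ x₁ = (diagram κ F).map f₂ x₂ at hx
    have hmem : (diagram κ F).map f₁ x₁ ∈ Set.range ((diagram κ F).map (g₁ ≫ f₁)) := by
      rw [range_diagram_map κ F (g₁ ≫ f₁) ⟨m₁ + m₂, add_mem hm₁ hm₂⟩ hρ]
      have e : AddMonoidAlgebra.single (⟨m₁ + m₂, add_mem hm₁ hm₂⟩ : dualMonoid σ.1) (1 : κ) =
          AddMonoidAlgebra.single ⟨m₁, hm₁⟩ 1 * AddMonoidAlgebra.single ⟨m₂, hm₂⟩ 1 := by
        rw [AddMonoidAlgebra.single_mul_single, one_mul]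
        rfl
      rw [e, PrimeSpectrum.basicOpen_mul]
      refine ⟨?_, ?_⟩
      · rw [← range_diagram_map κ F f₁ ⟨m₁, hm₁⟩ h₁]
        exact ⟨x₁, rfl⟩
      · rw [← range_diagram_map κ F f₂ ⟨m₂, hm₂⟩ h₂, hx]
        exact ⟨x₂, rfl⟩
    obtain ⟨x, hxx⟩ := hmem
    refine ⟨ρ, g₁, g₂, x, ?_, ?_⟩
    · apply ((diagram κ F).map f₁).isOpenEmbedding.injective
      rw [← hxx, Functor.map_comp]
      rfl
    · apply ((diagram κ F).map f₂).isOpenEmbedding.injective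
      rw [← hx, ← hxx, Subsingleton.elim (g₁ ≫ f₁) (g₂ ≫ f₂), Functor.map_comp]
      rfl

/-- The toric variety `X_F` over `κ`, glued from the affine charts `U_σ` along the open subschemes
`U_τ`, `τ` a face. -/
def toricVariety : Scheme.{u} := colimit (diagram κ F)

/-- The open immersion `U_σ → X_F`. -/
def chart (σ : F.Cone) : Spec (CommRingCat.of (ChartRing κ σ.1)) ⟶ toricVariety κ F :=
  colimit.ι (diagram κ F) σ

/-- The structure morphism `X_F → Spec κ`. -/
def toricStructure : toricVariety κ F ⟶ Spec (CommRingCat.of κ) :=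
  colimit.desc (diagram κ F)
    { pt := Spec (CommRingCat.of κ)
      ι :=
        { app := fun σ => Spec.map (CommRingCat.ofHom (algebraMap κ (ChartRing κ σ.1)))
          naturality := by
            intro τ σ h
            dsimp only [diagram, Functor.const_obj_obj, Functor.const_obj_map]
            rw [← Spec.map_comp, ← CommRingCat.ofHom_comp, Category.comp_id]
            congr 2
            exact AddMonoidAlgebra.mapDomainRingHom_comp_algebraMap _ } }

end Variety

end Fan

/-- Projective `n`-space over `κ`, as `Proj κ[x_0, …, x_n]`. -/
def projectiveSpace (κ : Type u) [Field κ] (n : ℕ) : Scheme.{u} :=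
  letI := MvPolynomial.gradedAlgebra (σ := Fin (n + 1)) (R := κ)
  Proj (MvPolynomial.homogeneousSubmodule (Fin (n + 1)) κ)

/-- The structure morphism of projective space. -/
def projectiveSpaceStructure (κ : Type u) [Field κ] (n : ℕ) :
    projectiveSpace κ n ⟶ Spec (CommRingCat.of κ) :=
  letI := MvPolynomial.gradedAlgebra (σ := Fin (n + 1)) (R := κ)
  Proj.toSpecZero (MvPolynomial.homogeneousSubmodule (Fin (n + 1)) κ) ≫
    Spec.map (CommRingCat.ofHom
      (algebraMap κ (MvPolynomial.homogeneousSubmodule (Fin (n + 1)) κ 0)))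

/-- A `κ`-scheme is quasi-projective if it admits an immersion over `κ` into some projective
space. -/
def IsQuasiProjective {κ : Type u} [Field κ] {X : Scheme.{u}} (s : X ⟶ Spec (CommRingCat.of κ)) :
    Prop :=
  ∃ (n : ℕ) (i : X ⟶ projectiveSpace κ n), IsImmersion i ∧ i ≫ projectiveSpaceStructure κ n = s

namespace Fan

section Hypersurface

variable {κ : Type u} [Field κ] {N : Type u} [AddCommGroup N] [Module.Free ℤ N] (F : Fan N)

/-- The anti-canonical monomial `x^m = ∏_ρ x_ρ ^ (⟨m, u_ρ⟩ + 1)` in the variables `x_ρ` indexed by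
the rays.  For `m ∈ ∇_F°`, all the exponents are nonnegative. -/
def monomial (κ : Type u) [Field κ] (m : DualLattice N) : MvPolynomial F.Ray κ :=
  ∏ v : F.Ray, MvPolynomial.X v ^ (m v.1 + 1).toNat

/-- The member `w = ∑_{m ∈ Ξ} c_m x^m` of the linear system of `Ξ`. -/
def polynomial (Ξ : Finset (DualLattice N)) (c : DualLattice N → κ) : MvPolynomial F.Ray κ :=
  ∑ m ∈ Ξ, MvPolynomial.C (c m) * F.monomial κ m

/-- The exponent vectors of the Laurent monomials in the `x_ρ` in which only the variables `x_ρ`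
with `ρ` not contained in `σ` may have negative exponents. -/
def coxMonoid (σ : PointedCone ℝ (RealSpan N)) : AddSubmonoid (F.Ray → ℤ) where
  carrier := {a | ∀ v : F.Ray, toReal v.1 ∈ σ → 0 ≤ a v}
  zero_mem' := fun _ _ => le_rfl
  add_mem' := fun ha hb v hv => add_nonneg (ha v hv) (hb v hv)

/-- The ring `κ[x_ρ] [x_ρ⁻¹, ρ ⊄ σ]` of the affine chart of the Cox open set that belongs to `σ`. -/
abbrev CoxRing (κ : Type u) [Field κ] (σ : PointedCone ℝ (RealSpan N)) : Type u :=
  AddMonoidAlgebra κ (F.coxMonoid σ)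

/-- The inclusion of the polynomial ring into the ring of a chart of the Cox open set. -/
def toCoxRing (σ : PointedCone ℝ (RealSpan N)) : MvPolynomial F.Ray κ →ₐ[κ] F.CoxRing κ σ :=
  letI := Classical.decEq F.Ray
  MvPolynomial.aeval fun v => AddMonoidAlgebra.single
    (⟨Pi.single v 1, fun v' _ => by
      rw [Pi.single_apply]
      split_ifs <;> norm_num⟩ : F.coxMonoid σ) 1

/-- The map `σ^∨ ∩ M → ℤ^{F(1)}`, `m ↦ (⟨m, u_ρ⟩)_ρ`, the divisor of `χ^m`. -/
def divHom (σ : PointedCone ℝ (RealSpan N)) : dualMonoid σ →+ F.coxMonoid σ where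
  toFun m := ⟨fun v => m.1 v.1, fun v hv => by
    have h := m.2 _ hv
    rw [realExt_toReal] at h
    exact_mod_cast h⟩
  map_zero' := rfl
  map_add' _ _ := rfl

/-- The ring map `χ^m ↦ ∏_ρ x_ρ ^ ⟨m, u_ρ⟩` of the quotient map from the chart of the Cox open set
to `U_σ`; it identifies `κ[σ^∨ ∩ M]` with the part of degree `0`. -/
def coxQuotientMap (κ : Type u) [Field κ] (σ : PointedCone ℝ (RealSpan N)) :
    ChartRing κ σ →+* F.CoxRing κ σ :=
  AddMonoidAlgebra.mapDomainRingHom κ (F.divHom σ)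

/-- The ideal of `{w = 0}` in `κ[σ^∨ ∩ M]`: the degree `0` part of the homogeneous ideal generated
by `w`. -/
def hypersurfaceIdeal (w : MvPolynomial F.Ray κ) (σ : PointedCone ℝ (RealSpan N)) :
    Ideal (ChartRing κ σ) :=
  (Ideal.span {F.toCoxRing σ w}).comap (F.coxQuotientMap κ σ)

/-- The charts `{w = 0} ∩ U_σ`, mapped to `X_F`. -/
def hypersurfaceCharts (w : MvPolynomial F.Ray κ) :
    (∐ fun σ : F.Cone => Spec (CommRingCat.of (ChartRing κ σ.1 ⧸ F.hypersurfaceIdeal w σ.1))) ⟶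
      F.toricVariety κ :=
  Sigma.desc fun σ =>
    Spec.map (CommRingCat.ofHom (Ideal.Quotient.mk (F.hypersurfaceIdeal w σ.1))) ≫ F.chart κ σ

/-- The hypersurface `Z_{w,F}` in `X_F`: the closed subscheme whose restriction to each chart `U_σ`
is defined by the ideal of `{w = 0}` there.  These ideals are compatible with the localizations
`κ[σ^∨ ∩ M] → κ[τ^∨ ∩ M]`, so the closed subscheme they define is the scheme-theoretic union of its
charts. -/
def hypersurface (w : MvPolynomial F.Ray κ) : Scheme.{u} := (F.hypersurfaceCharts w).image

/-- The structure morphism `Z_{w,F} → X_F → Spec κ`. -/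
def hypersurfaceStructure (w : MvPolynomial F.Ray κ) :
    F.hypersurface w ⟶ Spec (CommRingCat.of κ) :=
  (F.hypersurfaceCharts w).imageι ≫ F.toricStructure κ

end Hypersurface

end Fan

end ToricHypersurface

end

open ToricHypersurface

/-!
The two hypersurfaces share a dense open subscheme, their intersection with the torus `T = Spec
κ[M]`, which is the chart `U_0` of the zero cone in both toric varieties.

*The torus part depends only on `∇`.*  On `T` all the `x_ρ` are invertible, and `w` is the unit
`∏ x_ρ` times the image of the Laurent polynomial `f = ∑ c_m χ^m`.  The ideal of `{w = 0} ∩ T`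
is thus the preimage of the ideal generated by the image of `f` under `κ[M] → κ[x_ρ^{±1}]`, `χ^m
↦ ∏ x_ρ^⟨m, u_ρ⟩`.  The image of `κ[M]` is a group algebra of a subgroup of the group of
exponents, hence a direct summand as a module over itself, of `κ[x_ρ^{±1}]`, and the preimage is
generated by `f` and the kernel (`mem_hypersurfaceIdeal_bot_iff`).  The kernel depends only on
which `m` agree on all the `u_ρ`, that is, on `∇` (`divHom_bot_eq_iff`).  So the two fans give
the same ideal (`hypersurfaceIdeal_bot_le`).

*The torus part is dense.*  Since no `x_ρ` divides `w`, all monomials are coprime to `w` in the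
factorial ring `κ[x_ρ]`, so an element of the Cox ring of `U_σ` that `w` divides after all the
`x_ρ` are inverted is already divisible by `w`.  Hence the ideal of `{w = 0} ∩ U_σ` is the
preimage of that of `{w = 0} ∩ T` (`hypersurfaceIdeal_eq_comap`), so `{w = 0} ∩ T → {w = 0} ∩
U_σ` is scheme-theoretically dominant, and the hypersurface is the scheme-theoretic image of `{w
= 0} ∩ T` in `X` (`ker_hypersurfaceCharts`).  Finally, a quasi-compact immersion is a dense open
immersion into its scheme-theoretic image; the immersion of the affine scheme `{w = 0} ∩ T` is
quasi-compact because `X`, being quasi-projective, is quasi-separated.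
-/

/-! ### Divisibility in monoid algebras and polynomial rings -/

namespace AddMonoidAlgebra

variable {k G H : Type*} [CommRing k] [AddCommMonoid G] [AddCommMonoid H]

/-- Up to an element that multiplication by the image of `k[G]` keeps supported outside `φ(G)`,
every element of `k[H]` comes from `k[G]`. -/
lemma exists_forall_coeff_mapDomain_mul_sub_eq_zero (φ : G →+ H) (hG : ∀ a : G, ∃ b, b + a = 0)
    (y : AddMonoidAlgebra k H) :
    ∃ x : AddMonoidAlgebra k G, ∀ (f : AddMonoidAlgebra k G) (a : G),
      (mapDomainRingHom k φ f * (y - mapDomainRingHom k φ x)).coeff (φ a) = 0 := by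
  induction y using induction_linear with
  | zero => exact ⟨0, by simp⟩
  | add y y' hy hy' =>
    obtain ⟨x, hx⟩ := hy
    obtain ⟨x', hx'⟩ := hy'
    refine ⟨x + x', fun f a => ?_⟩
    rw [map_add, add_sub_add_comm, mul_add, coeff_add, Finsupp.add_apply, hx, hx', add_zero]
  | single b r =>
    by_cases hb : b ∈ Set.range φ
    · obtain ⟨c, rfl⟩ := hb
      exact ⟨single c r, by simp⟩
    · refine ⟨0, fun f a => ?_⟩
      rw [map_zero, sub_zero]
      induction f using induction_linear with
      | zero => simp
      | add f f' hf hf' => rw [map_add, add_mul, coeff_add, Finsupp.add_apply, hf, hf', add_zero]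
      | single d s =>
        rw [mapDomainRingHom_apply, mapDomain_single, single_mul_single, coeff_single,
          Finsupp.single_eq_of_ne]
        intro h
        obtain ⟨e, he⟩ := hG d
        refine hb ⟨e + a, ?_⟩
        rw [map_add, h, ← add_assoc, ← map_add, he, map_zero, zero_add]

/-- If `G` is a group, then divisibility of images under `k[G] → k[H]` can be tested in the image
`k[φ(G)]`: the span of the monomials outside `φ(G)` is a complement of `k[φ(G)]` in `k[H]` as a
`k[φ(G)]`-module. -/
lemma mapDomainRingHom_dvd_iff (φ : G →+ H) (hG : ∀ a : G, ∃ b, b + a = 0)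
    (f g : AddMonoidAlgebra k G) :
    mapDomainRingHom k φ f ∣ mapDomainRingHom k φ g ↔
      ∃ x, mapDomainRingHom k φ (g - f * x) = 0 := by
  constructor
  · rintro ⟨y, hy⟩
    obtain ⟨x, hx⟩ := exists_forall_coeff_mapDomain_mul_sub_eq_zero φ hG y
    have key : mapDomainRingHom k φ (g - f * x) =
        mapDomainRingHom k φ f * (y - mapDomainRingHom k φ x) := by
      rw [map_sub, map_mul, hy, mul_sub]
    refine ⟨x, ?_⟩
    ext b
    by_cases hb : b ∈ Set.range φ
    · obtain ⟨a, rfl⟩ := hb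
      rw [key, hx, coeff_zero, Finsupp.zero_apply]
    · exact Finsupp.mapDomain_of_notMem_range _ _ hb
  · rintro ⟨x, hx⟩
    rw [map_sub, map_mul, sub_eq_zero] at hx
    exact ⟨_, hx⟩

/-- The kernel of `k[G] → k[H]` depends only on the fibres of `G → H`. -/
lemma mapDomainRingHom_eq_zero_of_factors {H' : Type*} [AddCommMonoid H'] (φ : G →+ H)
    (ψ : G →+ H') (h : ∀ a b, φ a = φ b → ψ a = ψ b) {x : AddMonoidAlgebra k G}
    (hx : mapDomainRingHom k φ x = 0) : mapDomainRingHom k ψ x = 0 := by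
  have hψ : (ψ : G → H') = Function.extend φ ψ 0 ∘ φ :=
    (Function.FactorsThrough.extend_comp (f := φ) (g := ψ) 0 fun a b hab => h a b hab).symm
  have hx' : Finsupp.mapDomain φ x.coeff = 0 := congrArg coeff hx
  ext1
  change Finsupp.mapDomain ψ x.coeff = 0
  rw [hψ, Finsupp.mapDomain_comp, hx', Finsupp.mapDomain_zero]

end AddMonoidAlgebra

namespace MvPolynomial

/-- Monomials are coprime to a polynomial that no variable divides. -/
lemma dvd_of_dvd_monomial_mul {ι k : Type*} [Field k] {w p : MvPolynomial ι k}
    (hw : ∀ i, ¬ X i ∣ w) (d : ι →₀ ℕ) (h : w ∣ monomial d 1 * p) : w ∣ p := by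
  refine IsRelPrime.dvd_of_dvd_mul_left ?_ h
  rw [monomial_eq, C_1, one_mul]
  exact IsRelPrime.prod_right fun i _ => IsRelPrime.pow_right
    ((X_prime.irreducible.isRelPrime_iff_not_dvd.2 (hw i)).symm)

end MvPolynomial

namespace ToricHypersurface

namespace Fan

section Ideals

variable {κ : Type u} [Field κ] {N : Type u} [AddCommGroup N] (F : Fan N)

/-! ### Cox rings of the charts and ideals of the hypersurface -/

/-- The inclusion of the exponent vectors of the monomials of the polynomial ring into those of a
chart of the Cox open set. -/
noncomputable def natToCox (σ : PointedCone ℝ (RealSpan N)) : (F.Ray →₀ ℕ) →+ F.coxMonoid σ where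
  toFun d := ⟨fun v => d v, fun _ _ => Int.natCast_nonneg _⟩
  map_zero' := by ext; simp
  map_add' _ _ := by ext; simp

lemma natToCox_apply (σ : PointedCone ℝ (RealSpan N)) (d : F.Ray →₀ ℕ) (v : F.Ray) :
    (F.natToCox σ d).1 v = d v := rfl

lemma natToCox_injective (σ : PointedCone ℝ (RealSpan N)) :
    Function.Injective (F.natToCox σ) := fun d e h => by
  ext v
  have := congrFun (congrArg Subtype.val h) v
  rw [natToCox_apply, natToCox_apply] at this
  exact_mod_cast this

lemma mem_dualMonoid_bot (m : DualLattice N) :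
    m ∈ dualMonoid (⊥ : PointedCone ℝ (RealSpan N)) := by
  intro x hx
  rw [(Submodule.mem_bot _).1 hx, map_zero]

/-- The Laurent polynomial `∑ c_m χ^m` on the torus. -/
noncomputable def laurent (Ξ : Finset (DualLattice N)) (c : DualLattice N → κ) :
    ChartRing κ (⊥ : PointedCone ℝ (RealSpan N)) :=
  ∑ m ∈ Ξ, AddMonoidAlgebra.single ⟨m, mem_dualMonoid_bot m⟩ (c m)

lemma neg_one_le_of_realExt_mem_polar {m : DualLattice N} (hm : realExt m ∈ polar F.nabla)
    (v : F.Ray) : -1 ≤ m v.1 := by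
  have h := hm (toReal v.1) (subset_convexHull ℝ _ ⟨v.1, v.2, rfl⟩)
  rw [realExt_toReal] at h
  exact_mod_cast h

/-- `m` and `m'` have the same divisor exactly if they agree on `∇_F`.  In particular, the fibres of
`m ↦ (⟨m, u_ρ⟩)_ρ` depend only on `∇_F`. -/
lemma divHom_bot_eq_iff (m m' : dualMonoid (⊥ : PointedCone ℝ (RealSpan N))) :
    F.divHom ⊥ m = F.divHom ⊥ m' ↔ ∀ x ∈ F.nabla, realExt m.1 x = realExt m'.1 x := by
  constructor
  · intro h x hx
    have hsub : F.nabla ⊆ {x | realExt m.1 x = realExt m'.1 x} := by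
      refine convexHull_min ?_ (LinearMap.eqLocus (realExt m.1) (realExt m'.1)).convex
      rintro _ ⟨v, hv, rfl⟩
      have := congrFun (congrArg Subtype.val h) ⟨v, hv⟩
      change m.1 v = m'.1 v at this
      simp [realExt_toReal, this]
    exact hsub hx
  · intro h
    ext v
    have := h _ (subset_convexHull ℝ _ ⟨v.1, v.2, rfl⟩)
    rw [realExt_toReal, realExt_toReal] at this
    exact_mod_cast this

lemma toCoxRing_eq_mapDomainAlgHom (σ : PointedCone ℝ (RealSpan N)) :
    F.toCoxRing (κ := κ) σ = AddMonoidAlgebra.mapDomainAlgHom κ κ (F.natToCox σ) := by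
  let _ := Classical.decEq F.Ray
  refine MvPolynomial.algHom_ext fun v => ?_
  rw [toCoxRing, MvPolynomial.aeval_X, MvPolynomial.X, MvPolynomial.monomial]
  change _ = AddMonoidAlgebra.mapDomain _ (AddMonoidAlgebra.single _ _)
  rw [AddMonoidAlgebra.mapDomain_single]
  congr 1
  ext v'
  change (Pi.single v 1 : F.Ray → ℤ) v' = ((Finsupp.single v 1 : F.Ray →₀ ℕ) v' : ℤ)
  rw [Pi.single_apply, Finsupp.single_apply]
  simp [eq_comm]

lemma toCoxRing_injective (σ : PointedCone ℝ (RealSpan N)) :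
    Function.Injective (F.toCoxRing (κ := κ) σ) := by
  rw [toCoxRing_eq_mapDomainAlgHom]
  exact AddMonoidAlgebra.mapDomain_injective (F.natToCox_injective σ)

lemma toCoxRing_monomial (σ : PointedCone ℝ (RealSpan N)) (d : F.Ray →₀ ℕ) (r : κ) :
    F.toCoxRing σ (MvPolynomial.monomial d r) = AddMonoidAlgebra.single (F.natToCox σ d) r := by
  rw [toCoxRing_eq_mapDomainAlgHom]
  exact AddMonoidAlgebra.mapDomain_single

variable [Module.Free ℤ N]

lemma toReal_ne_zero {v : N} (hv : v ≠ 0) : toReal v ≠ 0 := by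
  intro h
  refine hv ((Module.forall_dual_apply_eq_zero_iff ℤ v).1 fun m => ?_)
  have h1 := realExt_toReal m v
  rw [h, map_zero] at h1
  exact_mod_cast h1.symm

lemma mem_coxMonoid_bot (a : F.Ray → ℤ) : a ∈ F.coxMonoid ⊥ := fun v hv =>
  absurd (by simpa using hv) (toReal_ne_zero v.2.1)

/-- The ring of a chart of the Cox open set consists of fractions of polynomials by monomials that
are invertible on the chart. -/
lemma exists_monomial_mul_eq_toCoxRing (σ : PointedCone ℝ (RealSpan N)) (a : F.CoxRing κ σ) :
    ∃ (d : F.Ray →₀ ℕ) (p : MvPolynomial F.Ray κ),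
      IsUnit (F.toCoxRing σ (MvPolynomial.monomial d (1 : κ))) ∧
        F.toCoxRing σ (MvPolynomial.monomial d 1) * a = F.toCoxRing σ p := by
  classical
  induction a using AddMonoidAlgebra.induction_linear with
  | zero =>
    refine ⟨0, 0, ?_, by simp⟩
    rw [MvPolynomial.monomial_zero', MvPolynomial.C_1, map_one]
    exact isUnit_one
  | add a b ha hb =>
    obtain ⟨d, p, hd, hp⟩ := ha
    obtain ⟨e, q, he, hq⟩ := hb
    have hmul : MvPolynomial.monomial (d + e) (1 : κ) =
        MvPolynomial.monomial d 1 * MvPolynomial.monomial e 1 := by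
      rw [MvPolynomial.monomial_mul, one_mul]
    refine ⟨d + e, MvPolynomial.monomial e 1 * p + MvPolynomial.monomial d 1 * q, ?_, ?_⟩
    · rw [hmul, map_mul]
      exact hd.mul he
    · rw [hmul, map_mul, map_add, map_mul, map_mul, ← hp, ← hq]
      ring
  | single m r =>
    -- `d` clears the negative exponents, which occur only at rays outside `σ`.
    let d : F.Ray →₀ ℕ := Finsupp.equivFunOnFinite.symm fun v =>
      if toReal v.1 ∈ σ then 0 else (m.1 v).natAbs
    have hd : ∀ v, d v = if toReal v.1 ∈ σ then 0 else (m.1 v).natAbs := fun v => rfl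
    let e : F.Ray →₀ ℕ := Finsupp.equivFunOnFinite.symm fun v => (m.1 v + d v).toNat
    refine ⟨d, MvPolynomial.monomial e r, ?_, ?_⟩
    · have hneg : (fun v => -(d v : ℤ)) ∈ F.coxMonoid σ := fun v hv => by simp [hd, hv]
      refine IsUnit.of_mul_eq_one (AddMonoidAlgebra.single ⟨_, hneg⟩ 1) ?_
      rw [toCoxRing_monomial, AddMonoidAlgebra.single_mul_single, one_mul,
        AddMonoidAlgebra.one_def]
      congr 1
      ext v
      exact add_neg_cancel (d v : ℤ)
    · rw [toCoxRing_monomial, toCoxRing_monomial, AddMonoidAlgebra.single_mul_single, one_mul]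
      congr 1
      ext v
      change (d v : ℤ) + m.1 v = ((m.1 v + d v).toNat : ℤ)
      have : 0 ≤ m.1 v + d v := by
        rw [hd]
        split_ifs with hv
        · simpa using m.2 v hv
        · omega
      rw [Int.toNat_of_nonneg this, add_comm]

/-- If no variable divides `w`, then inverting variables creates no new multiples of `w` among the
polynomials. -/
lemma dvd_of_toCoxRing_dvd (σ : PointedCone ℝ (RealSpan N)) {w p : MvPolynomial F.Ray κ}
    (hw : ∀ v, ¬ MvPolynomial.X v ∣ w) (h : F.toCoxRing σ w ∣ F.toCoxRing σ p) : w ∣ p := by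
  obtain ⟨b, hb⟩ := h
  obtain ⟨d, q, -, hq⟩ := F.exists_monomial_mul_eq_toCoxRing σ b
  refine MvPolynomial.dvd_of_dvd_monomial_mul hw d ⟨q, F.toCoxRing_injective σ ?_⟩
  rw [map_mul, map_mul, ← hq, hb]
  ring

/-- The inclusion `κ[x_ρ][x_ρ⁻¹, ρ ⊄ σ] → κ[x_ρ^{±1}]`. -/
noncomputable def coxToTorus (κ : Type u) [Field κ] (σ : PointedCone ℝ (RealSpan N)) :
    F.CoxRing κ σ →+* F.CoxRing κ ⊥ :=
  AddMonoidAlgebra.mapDomainRingHom κ (AddSubmonoid.inclusion fun a _ => F.mem_coxMonoid_bot a)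

lemma coxToTorus_toCoxRing (σ : PointedCone ℝ (RealSpan N)) (p : MvPolynomial F.Ray κ) :
    F.coxToTorus κ σ (F.toCoxRing σ p) = F.toCoxRing ⊥ p := by
  induction p using MvPolynomial.induction_on' with
  | monomial d r =>
    rw [toCoxRing_monomial, toCoxRing_monomial]
    exact AddMonoidAlgebra.mapDomain_single
  | add p q hp hq => rw [map_add, map_add, map_add, hp, hq]

lemma coxToTorus_coxQuotientMap (σ : PointedCone ℝ (RealSpan N)) (g : ChartRing κ σ) :
    F.coxToTorus κ σ (F.coxQuotientMap κ σ g) = F.coxQuotientMap κ ⊥ (chartMap κ bot_le g) := by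
  induction g using AddMonoidAlgebra.induction_linear with
  | zero => simp
  | add a b ha hb => simp only [map_add, ha, hb]
  | single m r =>
    simp only [coxToTorus, coxQuotientMap, chartMap, AddMonoidAlgebra.mapDomainRingHom_apply,
      AddMonoidAlgebra.mapDomain_single]
    rfl

/-- If no `x_ρ` divides `w`, then the hypersurface `{w = 0}` in `U_σ` is the scheme-theoretic
closure of its restriction to the torus. -/
lemma hypersurfaceIdeal_eq_comap (σ : PointedCone ℝ (RealSpan N)) {w : MvPolynomial F.Ray κ}
    (hw : ∀ v, ¬ MvPolynomial.X v ∣ w) :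
    F.hypersurfaceIdeal w σ = (F.hypersurfaceIdeal w ⊥).comap (chartMap κ bot_le) := by
  ext g
  simp only [hypersurfaceIdeal, Ideal.mem_comap, Ideal.mem_span_singleton,
    ← coxToTorus_coxQuotientMap]
  constructor
  · intro h
    rw [← coxToTorus_toCoxRing (σ := σ)]
    exact map_dvd _ h
  · intro h
    obtain ⟨d, p, hd, hp⟩ := F.exists_monomial_mul_eq_toCoxRing σ (F.coxQuotientMap κ σ g)
    refine hd.dvd_mul_left.1 ?_
    rw [hp]
    refine map_dvd _ (F.dvd_of_toCoxRing_dvd ⊥ hw ?_)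
    rw [← coxToTorus_toCoxRing (σ := σ) (p := p), ← hp, map_mul]
    exact h.mul_left _

/-- On the torus, `w` is the product of the unit `∏ x_ρ` and the pullback of `∑ c_m χ^m`. -/
lemma toCoxRing_bot_polynomial {Ξ : Finset (DualLattice N)}
    (hΞ : ∀ m ∈ Ξ, realExt m ∈ polar F.nabla) (c : DualLattice N → κ) :
    F.toCoxRing ⊥ (F.polynomial Ξ c) =
      AddMonoidAlgebra.single ⟨1, F.mem_coxMonoid_bot 1⟩ 1 *
        F.coxQuotientMap κ ⊥ (laurent Ξ c) := by
  rw [polynomial, laurent, map_sum, map_sum, Finset.mul_sum]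
  refine Finset.sum_congr rfl fun m hm => ?_
  have hmon : MvPolynomial.C (c m) * F.monomial κ m = MvPolynomial.monomial
      (Finsupp.equivFunOnFinite.symm fun v : F.Ray => (m v.1 + 1).toNat) (c m) := by
    rw [MvPolynomial.monomial_eq, Finsupp.prod_fintype _ _ fun _ => pow_zero _]
    rfl
  rw [hmon, toCoxRing_monomial, coxQuotientMap, AddMonoidAlgebra.mapDomainRingHom_apply,
    AddMonoidAlgebra.mapDomain_single, AddMonoidAlgebra.single_mul_single, one_mul]
  congr 1
  ext v
  change ((m v.1 + 1).toNat : ℤ) = 1 + m v.1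
  have := F.neg_one_le_of_realExt_mem_polar (hΞ m hm) v
  omega

/-- The restriction of `{w = 0}` to the torus is defined by `∑ c_m χ^m`, up to the kernel of
`κ[M] → κ[x_ρ^{±1}]`. -/
lemma mem_hypersurfaceIdeal_bot_iff {Ξ : Finset (DualLattice N)}
    (hΞ : ∀ m ∈ Ξ, realExt m ∈ polar F.nabla) (c : DualLattice N → κ)
    (g : ChartRing κ (⊥ : PointedCone ℝ (RealSpan N))) :
    g ∈ F.hypersurfaceIdeal (F.polynomial Ξ c) ⊥ ↔
      ∃ x, F.coxQuotientMap κ ⊥ (g - laurent Ξ c * x) = 0 := by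
  have hu : IsUnit (AddMonoidAlgebra.single (⟨1, F.mem_coxMonoid_bot 1⟩ : F.coxMonoid ⊥)
      (1 : κ)) := by
    refine IsUnit.of_mul_eq_one
      (AddMonoidAlgebra.single ⟨-1, F.mem_coxMonoid_bot (-1)⟩ 1) ?_
    rw [AddMonoidAlgebra.single_mul_single, one_mul, AddMonoidAlgebra.one_def]
    congr 1
  rw [hypersurfaceIdeal, Ideal.mem_comap, Ideal.mem_span_singleton,
    F.toCoxRing_bot_polynomial hΞ c, hu.mul_left_dvd]
  exact AddMonoidAlgebra.mapDomainRingHom_dvd_iff (F.divHom ⊥)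
    (fun a => ⟨⟨-a.1, mem_dualMonoid_bot _⟩, Subtype.ext (neg_add_cancel a.1)⟩) _ _

lemma hypersurfaceIdeal_bot_le {F₁ F₂ : Fan N} (hnabla : F₁.nabla = F₂.nabla)
    {Ξ : Finset (DualLattice N)} (hΞ : ∀ m ∈ Ξ, realExt m ∈ polar F₁.nabla)
    (c : DualLattice N → κ) :
    F₁.hypersurfaceIdeal (F₁.polynomial Ξ c) ⊥ ≤ F₂.hypersurfaceIdeal (F₂.polynomial Ξ c) ⊥ := by
  intro g hg
  obtain ⟨x, hx⟩ := (F₁.mem_hypersurfaceIdeal_bot_iff hΞ c g).1 hg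
  refine (F₂.mem_hypersurfaceIdeal_bot_iff (hnabla ▸ hΞ) c g).2 ⟨x, ?_⟩
  refine AddMonoidAlgebra.mapDomainRingHom_eq_zero_of_factors (F₁.divHom ⊥) (F₂.divHom ⊥) ?_ hx
  intro m m' h
  rwa [divHom_bot_eq_iff, ← hnabla, ← divHom_bot_eq_iff]

end Ideals

end Fan

end ToricHypersurface

/-! ### Scheme-theoretic images -/

namespace AlgebraicGeometry

lemma Spec.ker_map_eq_bot_of_injective {R S : CommRingCat.{u}} (φ : R ⟶ S)
    (hφ : Function.Injective φ) : (Spec.map φ).ker = ⊥ := by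
  refine Scheme.IdealSheafData.ext_of_isAffine ?_
  rw [Scheme.Hom.ker_apply _ ⟨⊤, isAffineOpen_top _⟩, Scheme.IdealSheafData.ideal_bot,
    Pi.bot_apply, ← RingHom.injective_iff_ker_eq_bot]
  have h : Function.Injective ((Scheme.ΓSpecIso R).hom ≫ φ) :=
    hφ.comp (ConcreteCategory.bijective_of_isIso (Scheme.ΓSpecIso R).hom).1
  rw [← Scheme.ΓSpecIso_naturality] at h
  exact Function.Injective.of_comp h

/-- A quasi-compact immersion is a dense open immersion into its scheme-theoretic image. -/
lemma Scheme.birationalOver_subschemeι_of_ker_eq {S X Y : Scheme.{u}} (g : Y ⟶ X)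
    [IsImmersion g] [QuasiCompact g] (I : X.IdealSheafData) (hI : I = g.ker) (s : X ⟶ S) :
    Scheme.BirationalOver (g ≫ s) (I.subschemeι ≫ s) := by
  subst hI
  exact Scheme.Hom.birationalOver g.toImage _ _ (by rw [Scheme.Hom.toImage_imageι_assoc])

lemma Scheme.Hom.le_ker_sigmaDesc {ι : Type u} {X : Scheme.{u}} (Y : ι → Scheme.{u})
    (f : ∀ i, Y i ⟶ X) (I : X.IdealSheafData) (h : ∀ i, I ≤ (f i).ker) :
    I ≤ (Sigma.desc f).ker := by
  let l : ∐ Y ⟶ I.subscheme := Sigma.desc fun i =>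
    IsClosedImmersion.lift I.subschemeι (f i) (by simpa using h i)
  have hl : l ≫ I.subschemeι = Sigma.desc f := by
    ext i : 1
    simp [l]
  rw [← hl]
  simpa using Scheme.Hom.le_ker_comp l I.subschemeι

end AlgebraicGeometry

/-! ### The hypersurface as the closure of its torus part -/

namespace ToricHypersurface

instance (κ : Type u) [Field κ] (n : ℕ) : (projectiveSpace κ n).IsSeparated := by
  let _ := MvPolynomial.gradedAlgebra (σ := Fin (n + 1)) (R := κ)
  exact inferInstanceAs
    (Proj (MvPolynomial.homogeneousSubmodule (Fin (n + 1)) κ)).IsSeparated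

lemma IsQuasiProjective.quasiSeparatedSpace {κ : Type u} [Field κ] {X : Scheme.{u}}
    {s : X ⟶ Spec (CommRingCat.of κ)} (h : IsQuasiProjective s) : QuasiSeparatedSpace X := by
  obtain ⟨n, i, hi, -⟩ := h
  exact quasiSeparatedSpace_of_quasiSeparated i

namespace Fan

variable {κ : Type u} [Field κ] {N : Type u} [AddCommGroup N] (F : Fan N)

instance (σ : F.Cone) : IsOpenImmersion (F.chart κ σ) :=
  inferInstanceAs (IsOpenImmersion (colimit.ι (diagram κ F) σ))

/-- The zero cone, whose chart is the torus. -/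
abbrev zeroCone : F.Cone := ⟨⊥, F.bot_mem⟩

lemma chart_toricStructure (σ : F.Cone) :
    F.chart κ σ ≫ F.toricStructure κ =
      Spec.map (CommRingCat.ofHom (algebraMap κ (ChartRing κ σ.1))) :=
  colimit.ι_desc _ _

lemma chart_zeroCone (σ : F.Cone) :
    F.chart κ F.zeroCone =
      Spec.map (CommRingCat.ofHom (chartMap κ (bot_le : F.zeroCone.1 ≤ σ.1))) ≫ F.chart κ σ :=
  (colimit.w (diagram κ F) (homOfLE (bot_le : (⊥ : PointedCone ℝ (RealSpan N)) ≤ σ.1) :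
    F.zeroCone ⟶ σ)).symm

/-- The part `{w = 0} ∩ U_σ` of the hypersurface in the chart `U_σ`, mapped to `X_F`. -/
noncomputable def hypersurfaceChart (w : MvPolynomial F.Ray κ) (σ : F.Cone) :
    Spec (CommRingCat.of (ChartRing κ σ.1 ⧸ F.hypersurfaceIdeal w σ.1)) ⟶ F.toricVariety κ :=
  Spec.map (CommRingCat.ofHom (Ideal.Quotient.mk (F.hypersurfaceIdeal w σ.1))) ≫ F.chart κ σ

instance (w : MvPolynomial F.Ray κ) (σ : F.Cone) : IsImmersion (F.hypersurfaceChart w σ) := by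
  have : IsClosedImmersion
      (Spec.map (CommRingCat.ofHom (Ideal.Quotient.mk (F.hypersurfaceIdeal w σ.1)))) :=
    IsClosedImmersion.spec_of_surjective _ Ideal.Quotient.mk_surjective
  exact IsImmersion.comp _ _

instance [QuasiSeparatedSpace (F.toricVariety κ)] (w : MvPolynomial F.Ray κ) (σ : F.Cone) :
    QuasiCompact (F.hypersurfaceChart w σ) :=
  quasiCompact_of_compactSpace _

lemma hypersurfaceChart_toricStructure (w : MvPolynomial F.Ray κ) (σ : F.Cone) :
    F.hypersurfaceChart w σ ≫ F.toricStructure κ =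
      Spec.map (CommRingCat.ofHom
        (algebraMap κ (ChartRing κ σ.1 ⧸ F.hypersurfaceIdeal w σ.1))) := by
  rw [hypersurfaceChart, Category.assoc, chart_toricStructure, ← Spec.map_comp,
    ← CommRingCat.ofHom_comp]

variable [Module.Free ℤ N]

/-- `{w = 0} ∩ T` and `{w = 0} ∩ U_σ` have the same closure in `X_F`: the restriction of functions
from the latter to the former is injective. -/
lemma ker_hypersurfaceChart_eq {w : MvPolynomial F.Ray κ} (hw : ∀ v, ¬ MvPolynomial.X v ∣ w)
    (σ : F.Cone) : (F.hypersurfaceChart w σ).ker = (F.hypersurfaceChart w F.zeroCone).ker := by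
  have hle := (F.hypersurfaceIdeal_eq_comap σ.1 hw).le
  let φ : ChartRing κ σ.1 ⧸ F.hypersurfaceIdeal w σ.1 →+*
      ChartRing κ F.zeroCone.1 ⧸ F.hypersurfaceIdeal w F.zeroCone.1 :=
    Ideal.quotientMap _ (chartMap κ bot_le) hle
  have hφ : Function.Injective φ :=
    Ideal.quotientMap_injective' (F.hypersurfaceIdeal_eq_comap σ.1 hw).ge
  have hfac : F.hypersurfaceChart w F.zeroCone =
      Spec.map (CommRingCat.ofHom φ) ≫ F.hypersurfaceChart w σ := by
    rw [hypersurfaceChart, hypersurfaceChart, chart_zeroCone F σ, ← Spec.map_comp_assoc,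
      ← Spec.map_comp_assoc, ← CommRingCat.ofHom_comp, ← CommRingCat.ofHom_comp,
      Ideal.quotientMap_comp_mk]
  rw [hfac, Scheme.Hom.ker_comp, Spec.ker_map_eq_bot_of_injective _ hφ,
    Scheme.IdealSheafData.map_bot]

lemma ker_hypersurfaceCharts {w : MvPolynomial F.Ray κ} (hw : ∀ v, ¬ MvPolynomial.X v ∣ w) :
    (F.hypersurfaceCharts w).ker = (F.hypersurfaceChart w F.zeroCone).ker := by
  refine le_antisymm ?_
    (Scheme.Hom.le_ker_sigmaDesc _ _ _ fun σ => (F.ker_hypersurfaceChart_eq hw σ).ge)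
  have h : F.hypersurfaceChart w F.zeroCone = Sigma.ι (fun σ : F.Cone =>
      Spec (CommRingCat.of (ChartRing κ σ.1 ⧸ F.hypersurfaceIdeal w σ.1))) F.zeroCone ≫
        F.hypersurfaceCharts w :=
    (Sigma.ι_desc (F.hypersurfaceChart w) F.zeroCone).symm
  rw [h]
  exact Scheme.Hom.le_ker_comp _ _

/-- If no `x_ρ` divides `w`, then `{w = 0} ∩ T` is a dense open subscheme of the hypersurface. -/
lemma birationalOver_hypersurfaceStructure [QuasiSeparatedSpace (F.toricVariety κ)]
    {w : MvPolynomial F.Ray κ} (hw : ∀ v, ¬ MvPolynomial.X v ∣ w) :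
    Scheme.BirationalOver
      (Spec.map (CommRingCat.ofHom (algebraMap κ (ChartRing κ ⊥ ⧸ F.hypersurfaceIdeal w ⊥))))
      (F.hypersurfaceStructure w) := by
  have h := Scheme.birationalOver_subschemeι_of_ker_eq (F.hypersurfaceChart w F.zeroCone) _
    (F.ker_hypersurfaceCharts hw) (F.toricStructure κ)
  rwa [hypersurfaceChart_toricStructure] at h

end Fan

end ToricHypersurface

/-! ### Comparison of the two fans -/

open ToricHypersurface
theorem proposition2p2 {κ : Type u} [Field κ] [CharZero κ]
    {N : Type u} [AddCommGroup N] [Module.Free ℤ N] [Module.Finite ℤ N]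
    (F₁ F₂ : Fan N)
    (hsimp₁ : F₁.IsSimplicial) (hsimp₂ : F₂.IsSimplicial)
    (hsupp₁ : F₁.HasFullDimConvexSupport) (hsupp₂ : F₂.HasFullDimConvexSupport)
    (hnabla : F₁.nabla = F₂.nabla)
    (hqp₁ : IsQuasiProjective (F₁.toricStructure κ))
    (hqp₂ : IsQuasiProjective (F₂.toricStructure κ))
    (Ξ : Finset (DualLattice N)) (hΞ : ∀ m ∈ Ξ, realExt m ∈ polar F₁.nabla)
    (c : DualLattice N → κ)
    (hw₁ : ∀ ρ : F₁.Ray, ¬ MvPolynomial.X ρ ∣ F₁.polynomial Ξ c)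
    (hw₂ : ∀ ρ : F₂.Ray, ¬ MvPolynomial.X ρ ∣ F₂.polynomial Ξ c) :
    Scheme.BirationalOver
      (F₁.hypersurfaceStructure (F₁.polynomial Ξ c))
      (F₂.hypersurfaceStructure (F₂.polynomial Ξ c)) := by
  have := hqp₁.quasiSeparatedSpace
  have := hqp₂.quasiSeparatedSpace
  have h₁ := F₁.birationalOver_hypersurfaceStructure hw₁
  have h₂ := F₂.birationalOver_hypersurfaceStructure hw₂
  rw [le_antisymm (Fan.hypersurfaceIdeal_bot_le hnabla hΞ c)
    (Fan.hypersurfaceIdeal_bot_le hnabla.symm (hnabla ▸ hΞ) c)] at h₁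
  exact h₁.symm.trans h₂
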